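/- Let $k\ge 0$ and let $\Lambda$ be a $k$-graph: a nonempty countable small category with a functor $d:\Lambda\to\mathbb N^k$ such that whenever $d(\lambda)=m+n$ there are unique $\mu,\nu\in\Lambda$ with $d(\mu)=m$, $d(\nu)=n$ and $\lambda=\mu\nu$. For $0\le m\le n\le d(\lambda)$ let $\lambda(m,n)$ be the unique path $\beta$ of degree $n-m$ such that $\lambda=\alpha\beta\gamma$ with $d(\alpha)=m$ and $d(\gamma)=d(\lambda)-n$. *The space $X_\Lambda$.* $X_\Lambda$ is the quotient of the topological disjoint union $\bigsqcup_{\lambda\in\Lambda}\{\lambda\}\times[0,d(\lambda)]$, where $[0,n]=\{t\in\mathbb R^k:0\le t\le n\}$, by the equivalence relation $$(\mu,s)\sim(\nu,t)\iff s-\lfloor s\rfloor=t-\lfloor t\rfloor\ \text{ and }\ \mu(\lfloor s\rfloor,\lceil s\rceil)=\nu(\lfloor t\rfloor,\lceil t\rceil)$$ (floors and ceilings are taken coordinatewise); $[\lambda,t]$ denotes the class of $(\lambda,t)$. *The cubical set $\widetilde Q(\Lambda)$.* For $r\ge 0$ write $\mathbf 1_r=(1,\dots,1)\in\mathbb N^r$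 and let $\Omega_{r,\mathbf 1_r}=\{(p,q)\in\mathbb N^r\times\mathbb N^r:p\le q\le \mathbf 1_r\}$ be the $r$-graph with range $(p,p)$, source $(q,q)$, degree $q-p$ and composition $(p,q)(q,q')=(p,q')$. A homomorphism $h:\mathbb N^r\to\mathbb N^k$ is admissible if there are $t\ge 0$, $i_1<\dots<i_t$ and $j_1<\dots<j_t$ with $h(e_{i_p})=e_{j_p}$ for $p\le t$ and $h(e_i)=0$ for $i\notin\{i_1,\dots,i_t\}$. $\widetilde Q_r(\Lambda)$ is the set of functors $\varphi:\Omega_{r,\mathbf 1_r}\to\Lambda$ for which there is an admissible $h$ with $d(\varphi(p,q))=h(q-p)$ for all $p\le q\le\mathbf 1_r$; this $h$ is unique. Faces and degeneracies are $\overline\varepsilon_i^\ell(\varphi)=\varphi\circ\varepsilon_i^\ell$ and $\overline\eta_i(\varphi)=\varphi\circ\eta_i$, where $\varepsilon_i^\ell$ inserts $\ell\in\{0,1\}$ as $i$-th coordinate and $\eta_i$ deletes the $i$-th coordinate (applied to both entries of $(p,q)$). *The geometric realisation.* $\mathcal R\widetilde Q(\Lambda)$ is the quotient of $\bigsqcup_{r\ge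 0}\bigsqcup_{\varphi\in\widetilde Q_r(\Lambda)}\{\varphi\}\times[0,1]^r$ by the equivalence relation generated by $(\overline\varepsilon_i^\ell(\varphi),t)\sim(\varphi,\dot\varepsilon_i^\ell(t))$ and $(\overline\eta_i(\varphi),t)\sim(\varphi,\dot\eta_i(t))$, where $\dot\varepsilon_i^\ell$ and $\dot\eta_i$ are the coordinate insertion and deletion maps on the cubes $[0,1]^r$; $\widehat\varphi:[0,1]^r\to\mathcal R\widetilde Q(\Lambda)$ denotes the canonical map that belongs to $\varphi$. For $\varphi\in\widetilde Q_r(\Lambda)$ with associated admissible map $h$, define $\widetilde\varphi:[0,1]^r\to X_\Lambda$ by $\widetilde\varphi(t)=\big[\varphi(0,\mathbf 1_r),\ \sum_{i=1}^r t_i h(e_i)\big]$. **Theorem.** There is a unique continuous map $\pi:\mathcal R\widetilde Q(\Lambda)\to X_\Lambda$ such that $\pi\circ\widehat\varphi=\widetilde\varphi$ for all $r\ge0$ and all $\varphi\in\widetilde Q_r(\Lambda)$, and this map $\pi$ is a homeomorphism. -/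

import Mathlib

open CategoryTheory

universe u v w

/-! ## Higher-rank graphs -/

/-- A `k`-graph: a nonempty countable small category with a degree functor to `ℕ ^ k` that has
the factorisation property.  A path `p : x ⟶ y` has source `x` and range `y`, so the composite
written `μ ν` in the literature on `k`-graphs (where `s μ = r ν`) is `ν ≫ μ` here. -/
structure KGraph (k : ℕ) where
  /-- the objects (vertices) -/
  Obj : Type u
  [cat : Category.{v} Obj]
  nonempty : Nonempty Obj
  countable : Countable (Σ x y : Obj, x ⟶ y)
  /-- the degree of a path -/
  degree : ∀ {x y : Obj}, (x ⟶ y) → (Fin k → ℕ)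
  degree_id : ∀ x : Obj, degree (𝟙 x) = 0
  degree_comp : ∀ {x y z : Obj} (f : x ⟶ y) (g : y ⟶ z), degree (f ≫ g) = degree f + degree g
  /-- the factorisation property -/
  factorisation : ∀ {x y : Obj} (p : x ⟶ y) (m n : Fin k → ℕ), degree p = m + n →
    ∃! q : Σ z : Obj, (z ⟶ y) × (x ⟶ z),
      degree q.2.1 = m ∧ degree q.2.2 = n ∧ q.2.2 ≫ q.2.1 = p

namespace KGraph

attribute [instance] KGraph.cat

variable {k : ℕ}

/-- The set of all paths (morphisms) of a `k`-graph; the fields `left`, `right` and `hom` of a path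
are its source, its range and the morphism. -/
abbrev Path (Γ : KGraph.{u, v} k) : Type (max u v) := Quiver.Total Γ.Obj

/-- The degree, as a function on the set of all paths. -/
def d (Γ : KGraph.{u, v} k) (p : Γ.Path) : Fin k → ℕ := Γ.degree p.hom

/-- For `m ≤ n ≤ d p` there is a unique path `b` for which there are paths `a`, `c` with
`p = a b c` and `d a = m`, `d b = n - m`, `d c = d p - n`. -/
theorem existsUnique_segment (Γ : KGraph.{u, v} k) (p : Γ.Path) (m n : Fin k → ℕ)
    (hmn : m ≤ n) (hn : n ≤ Γ.d p) :
    ∃! b : Γ.Path, ∃ (a : b.right ⟶ p.right) (c : p.left ⟶ b.left),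
      Γ.degree a = m ∧ Γ.degree b.hom = n - m ∧ Γ.degree c = Γ.d p - n ∧
        c ≫ b.hom ≫ a = p.hom := by
  obtain ⟨x, y, p⟩ := p
  change n ≤ Γ.degree p at hn
  change ∃! b : Γ.Path, ∃ (a : b.right ⟶ y) (c : x ⟶ b.left),
      Γ.degree a = m ∧ Γ.degree b.hom = n - m ∧ Γ.degree c = Γ.degree p - n ∧
        c ≫ b.hom ≫ a = p
  have h1 : Γ.degree p = m + (Γ.degree p - m) := (add_tsub_cancel_of_le (hmn.trans hn)).symm
  have h2 : Γ.degree p - m = (n - m) + (Γ.degree p - n) := by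
    funext i
    have h3 : m i ≤ n i := hmn i
    have h4 : n i ≤ Γ.degree p i := hn i
    simp only [Pi.sub_apply, Pi.add_apply]
    omega
  obtain ⟨⟨z, a, r⟩, ⟨ha, hr, har⟩, hu⟩ := Γ.factorisation p m _ h1
  simp only at ha hr har
  obtain ⟨⟨z', b, c⟩, ⟨hb, hc, hbc⟩, hu'⟩ := Γ.factorisation r _ _ (hr.trans h2)
  simp only at hb hc hbc
  refine ⟨⟨z', z, b⟩, ⟨a, c, ha, hb, hc, by simp only [← har, ← hbc, Category.assoc]⟩, ?_⟩
  rintro ⟨w', w, b'⟩ ⟨a', c', ha', hb', hc', h'⟩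
  simp only at ha' hb' hc' h' a' c'
  have e1 := hu ⟨w, a', c' ≫ b'⟩ ⟨ha', by rw [Γ.degree_comp, hb', hc', h2, add_comm],
    by simpa using h'⟩
  obtain ⟨rfl, e1⟩ := Sigma.mk.inj e1
  obtain ⟨rfl, rfl⟩ := Prod.mk.inj (eq_of_heq e1)
  have e2 := hu' ⟨w', b', c'⟩ ⟨hb', hc', rfl⟩
  obtain ⟨rfl, e2⟩ := Sigma.mk.inj e2
  obtain ⟨rfl, rfl⟩ := Prod.mk.inj (eq_of_heq e2)
  rfl

/-- The segment `p(m, n)` of a path `p`, for `m ≤ n ≤ d p`. -/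
noncomputable def segment (Γ : KGraph.{u, v} k) (p : Γ.Path) (m n : Fin k → ℕ)
    (hmn : m ≤ n) (hn : n ≤ Γ.d p) : Γ.Path :=
  Classical.choose (Γ.existsUnique_segment p m n hmn hn)

/-! ## The topological realisation of a `k`-graph -/

/-- The disjoint union of the spaces `{p} × [0, d p]` over all paths `p`. -/
abbrev Point (Γ : KGraph.{u, v} k) : Type (max u v) :=
  Σ p : Γ.Path, Set.Icc (0 : Fin k → ℝ) (fun i => (Γ.d p i : ℝ))

/-- The path `p(⌊t⌋, ⌈t⌉)` of a point `(p, t)`. -/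
noncomputable def cell (Γ : KGraph.{u, v} k) (x : Γ.Point) : Γ.Path :=
  Γ.segment x.1 (fun i => ⌊x.2.1 i⌋₊) (fun i => ⌈x.2.1 i⌉₊) (fun _ => Nat.floor_le_ceil _)
    (fun i => Nat.ceil_le.2 (x.2.2.2 i))

/-- The vector `t - ⌊t⌋` of a point `(p, t)`. -/
noncomputable def offset (Γ : KGraph.{u, v} k) (x : Γ.Point) : Fin k → ℝ :=
  fun i => x.2.1 i - (⌊x.2.1 i⌋₊ : ℝ)

/-- The relation `(p, s) ∼ (q, t)` iff `s - ⌊s⌋ = t - ⌊t⌋` and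
`p(⌊s⌋, ⌈s⌉) = q(⌊t⌋, ⌈t⌉)`. -/
def pointSetoid (Γ : KGraph.{u, v} k) : Setoid Γ.Point where
  r x y := Γ.offset x = Γ.offset y ∧ Γ.cell x = Γ.cell y
  iseqv :=
    { refl := fun _ => ⟨rfl, rfl⟩
      symm := fun h => ⟨h.1.symm, h.2.symm⟩
      trans := fun h h' => ⟨h.1.trans h'.1, h.2.trans h'.2⟩ }

/-- The topological realisation `X_Γ` of a `k`-graph `Γ`. -/
def Realisation (Γ : KGraph.{u, v} k) : Type (max u v) := Quotient Γ.pointSetoid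

/-- The quotient topology of the disjoint union topology. -/
instance (Γ : KGraph.{u, v} k) : TopologicalSpace Γ.Realisation :=
  inferInstanceAs (TopologicalSpace (Quotient Γ.pointSetoid))

/-- The class `[p, t]` of a point `(p, t)`. -/
def toRealisation (Γ : KGraph.{u, v} k) (x : Γ.Point) : Γ.Realisation :=
  Quotient.mk Γ.pointSetoid x

end KGraph

/-! ## Cubical sets and their geometric realisation -/

/-- The coface map that inserts the coordinate `ℓ ∈ {0, 1}` in position `i`. -/
def coface {α : Type*} [Zero α] [One α] {r : ℕ} (i : Fin (r + 1)) (l : Fin 2) (t : Fin r → α) :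
    Fin (r + 1) → α :=
  i.insertNth (α := fun _ => α) (if l = 0 then 0 else 1) t

/-- The codegeneracy map that deletes the `i`-th coordinate. -/
def codegen {α : Type*} {r : ℕ} (i : Fin (r + 1)) (t : Fin (r + 1) → α) : Fin r → α :=
  i.removeNth (α := fun _ => α) t

/-- A cubical set (with faces and degeneracies). The index `i` starts at `0`. -/
structure CubicalSet where
  /-- the `r`-cubes -/
  cubes : ℕ → Type w
  /-- the faces -/
  face : ∀ {r : ℕ}, Fin (r + 1) → Fin 2 → cubes (r + 1) → cubes r
  /-- the degeneracies -/
  degen : ∀ {r : ℕ}, Fin (r + 1) → cubes r → cubes (r + 1)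
  face_face : ∀ {r : ℕ} (i j : Fin (r + 1)) (l m : Fin 2) (x : cubes (r + 2)), j ≤ i →
    face i l (face j.castSucc m x) = face j m (face i.succ l x)
  degen_degen : ∀ {r : ℕ} (i j : Fin (r + 1)) (x : cubes r), j ≤ i →
    degen j.castSucc (degen i x) = degen i.succ (degen j x)
  face_degen_of_lt : ∀ {r : ℕ} (i j : Fin (r + 1)) (l : Fin 2) (x : cubes (r + 1)), j ≤ i →
    face i.succ l (degen j.castSucc x) = degen j (face i l x)
  face_degen_self : ∀ {r : ℕ} (i : Fin (r + 1)) (l : Fin 2) (x : cubes r),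
    face i l (degen i x) = x
  face_degen_of_gt : ∀ {r : ℕ} (i j : Fin (r + 1)) (l : Fin 2) (x : cubes (r + 1)), i ≤ j →
    face i.castSucc l (degen j.succ x) = degen j (face i l x)

namespace CubicalSet

/-- The disjoint union of the spaces `{x} × [0,1] ^ r`, over all `r` and all `r`-cubes `x`. -/
abbrev Point (K : CubicalSet.{w}) : Type w :=
  Σ r : ℕ, Σ _ : K.cubes r, (Fin r → unitInterval)

/-- The elementary identifications `(∂ x, t) ∼ (x, ε t)` and `(f x, t) ∼ (x, η t)`. -/
inductive Glue (K : CubicalSet.{w}) : K.Point → K.Point → Prop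
  | face {r : ℕ} (i : Fin (r + 1)) (l : Fin 2) (x : K.cubes (r + 1)) (t : Fin r → unitInterval) :
      Glue K ⟨r, K.face i l x, t⟩ ⟨r + 1, x, coface i l t⟩
  | degen {r : ℕ} (i : Fin (r + 1)) (x : K.cubes r) (t : Fin (r + 1) → unitInterval) :
      Glue K ⟨r + 1, K.degen i x, t⟩ ⟨r, x, codegen i t⟩

/-- The geometric realisation of a cubical set: the quotient of the disjoint union of cubes by the
equivalence relation that the elementary identifications generate. -/
def Realisation (K : CubicalSet.{w}) : Type w := Quot K.Glue

/-- The quotient topology of the disjoint union topology (each set of cubes is discrete). -/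
instance (K : CubicalSet.{w}) : TopologicalSpace K.Realisation :=
  inferInstanceAs (TopologicalSpace (Quot K.Glue))

/-- The structure map `[0,1] ^ r → R K` of an `r`-cube `x`. -/
def hat (K : CubicalSet.{w}) {r : ℕ} (x : K.cubes r) (t : Fin r → unitInterval) : K.Realisation :=
  Quot.mk K.Glue ⟨r, x, t⟩

theorem continuous_hat (K : CubicalSet.{w}) {r : ℕ} (x : K.cubes r) : Continuous (K.hat x) :=
  continuous_quot_mk.comp (continuous_sigmaMk.comp continuous_sigmaMk)

theorem hat_face (K : CubicalSet.{w}) {r : ℕ} (i : Fin (r + 1)) (l : Fin 2) (x : K.cubes (r + 1))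
    (t : Fin r → unitInterval) : K.hat x (coface i l t) = K.hat (K.face i l x) t :=
  (Quot.sound (Glue.face i l x t)).symm

theorem hat_degen (K : CubicalSet.{w}) {r : ℕ} (i : Fin (r + 1)) (x : K.cubes r)
    (t : Fin (r + 1) → unitInterval) : K.hat x (codegen i t) = K.hat (K.degen i x) t :=
  (Quot.sound (Glue.degen i x t)).symm

/-- The universal property that characterises the realisation together with its structure maps. -/
theorem existsUnique_desc (K : CubicalSet.{w}) {X : Type*} [TopologicalSpace X]
    (g : ∀ r : ℕ, K.cubes r → (Fin r → unitInterval) → X) (hg : ∀ r x, Continuous (g r x))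
    (hface : ∀ (r : ℕ) (i : Fin (r + 1)) (l : Fin 2) (x : K.cubes (r + 1)) t,
      g (r + 1) x (coface i l t) = g r (K.face i l x) t)
    (hdegen : ∀ (r : ℕ) (i : Fin (r + 1)) (x : K.cubes r) t,
      g r x (codegen i t) = g (r + 1) (K.degen i x) t) :
    ∃! f : C(K.Realisation, X), ∀ (r : ℕ) (x : K.cubes r) t, f (K.hat x t) = g r x t := by
  have hc : ∀ a b : K.Point, K.Glue a b → g a.1 a.2.1 a.2.2 = g b.1 b.2.1 b.2.2 := by
    rintro _ _ (⟨i, l, x, t⟩ | ⟨i, x, t⟩)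
    · exact (hface _ i l x t).symm
    · exact (hdegen _ i x t).symm
  refine ⟨⟨Quot.lift (fun a : K.Point => g a.1 a.2.1 a.2.2) hc, ?_⟩, fun _ _ _ => rfl, ?_⟩
  · exact continuous_quot_lift _ (continuous_sigma fun r => continuous_sigma fun x => hg r x)
  · intro f hf
    ext a
    obtain ⟨⟨r, x, t⟩, rfl⟩ := Quot.exists_rep a
    exact hf r x t

end CubicalSet

/-! ## Combinatorics of cofaces and codegeneracies -/

theorem succAbove_comm {r : ℕ} (i j : Fin (r + 1)) (hji : j ≤ i) (q : Fin r) :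
    j.castSucc.succAbove (i.succAbove q) = i.succ.succAbove (j.succAbove q) := by
  rw [Fin.le_def] at hji
  simp only [Fin.succAbove, Fin.lt_def, Fin.ext_iff]
  split_ifs <;> simp_all <;> omega

theorem codegen_codegen {α : Type*} {r : ℕ} (i j : Fin (r + 1)) (t : Fin (r + 2) → α) (hji : j ≤ i) :
    codegen i (codegen j.castSucc t) = codegen j (codegen i.succ t) := by
  funext q
  simp only [codegen, Fin.removeNth]
  rw [succAbove_comm i j hji]

section Tuples

variable {α : Type*} [Zero α] [One α] {r : ℕ}

theorem codegen_coface (i : Fin (r + 1)) (l : Fin 2) (t : Fin r → α) :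
    codegen i (coface i l t) = t := by
  simp [codegen, coface]

theorem coface_same (i : Fin (r + 1)) (l : Fin 2) (t : Fin r → α) :
    coface i l t i = if l = 0 then 0 else 1 := by
  simp [coface]

theorem coface_succAbove (i : Fin (r + 1)) (l : Fin 2) (t : Fin r → α) (q : Fin r) :
    coface i l t (i.succAbove q) = t q := by
  simp [coface]

theorem eq_coface_iff (i : Fin (r + 1)) (l : Fin 2) (t : Fin r → α) (g : Fin (r + 1) → α) :
    g = coface i l t ↔ (g i = if l = 0 then 0 else 1) ∧ ∀ q, g (i.succAbove q) = t q := by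
  unfold coface
  rw [Fin.eq_insertNth_iff, funext_iff]
  rfl

theorem coface_coface (i j : Fin (r + 1)) (l m : Fin 2) (t : Fin r → α) (hji : j ≤ i) :
    coface j.castSucc m (coface i l t) = coface i.succ l (coface j m t) := by
  have hj : i.succ.succAbove j = j.castSucc := Fin.succAbove_succ_of_le _ _ hji
  have hi : j.castSucc.succAbove i = i.succ := Fin.succAbove_castSucc_of_le _ _ hji
  symm
  rw [eq_coface_iff]
  refine ⟨by rw [← hj, coface_succAbove, coface_same], fun q => ?_⟩
  revert q
  have : (fun q => coface i.succ l (coface j m t) (j.castSucc.succAbove q)) = coface i l t := by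
    rw [eq_coface_iff]
    refine ⟨by rw [hi, coface_same], fun q => ?_⟩
    rw [succAbove_comm i j hji, coface_succAbove, coface_succAbove]
  exact fun q => congrFun this q

theorem codegen_coface_of_lt (i j : Fin (r + 1)) (l : Fin 2) (t : Fin (r + 1) → α)
    (hji : j ≤ i) : codegen j.castSucc (coface i.succ l t) = coface i l (codegen j t) := by
  have hi : j.castSucc.succAbove i = i.succ := Fin.succAbove_castSucc_of_le _ _ hji
  rw [eq_coface_iff]
  refine ⟨by simp only [codegen, Fin.removeNth]; rw [hi, coface_same], fun q => ?_⟩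
  simp only [codegen, Fin.removeNth]
  rw [succAbove_comm i j hji, coface_succAbove]

theorem codegen_coface_of_gt (i j : Fin (r + 1)) (l : Fin 2) (t : Fin (r + 1) → α)
    (hij : i ≤ j) : codegen j.succ (coface i.castSucc l t) = coface i l (codegen j t) := by
  have hi : j.succ.succAbove i = i.castSucc := Fin.succAbove_succ_of_le _ _ hij
  rw [eq_coface_iff]
  refine ⟨by simp only [codegen, Fin.removeNth]; rw [hi, coface_same], fun q => ?_⟩
  simp only [codegen, Fin.removeNth]
  rw [← succAbove_comm j i hij, coface_succAbove]

end Tuples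

/-! ## The cubes `Ω_{r, 1}` and the maps between them -/

/-- The `k`-graph `Ω_{k, m}`: its objects are the `p ∈ ℕ ^ k` with `p ≤ m`, and for `p ≤ q` there is
exactly one path, written `(p, q)`, with range `p` and source `q`; its degree is `q - p`. -/
@[reducible]
def Omega {k : ℕ} (m : Fin k → ℕ) : KGraph.{0, 0} k where
  Obj := (Set.Iic m)ᵒᵖ
  nonempty := ⟨Opposite.op ⟨m, Set.mem_Iic.2 le_rfl⟩⟩
  countable := by
    have : Countable (Set.Iic m)ᵒᵖ := Opposite.equivToOpposite.symm.countable_iff.2 inferInstance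
    infer_instance
  degree {x y} _ := x.unop.1 - y.unop.1
  degree_id x := by simp
  degree_comp {x y z} f g := by
    funext i
    have h1 : y.unop.1 i ≤ x.unop.1 i := leOfHom f.unop i
    have h2 : z.unop.1 i ≤ y.unop.1 i := leOfHom g.unop i
    simp only [Pi.sub_apply, Pi.add_apply]
    omega
  factorisation {x y} p a b hab := by
    have hp : ∀ i, y.unop.1 i ≤ x.unop.1 i := fun i => leOfHom p.unop i
    have hab' : ∀ i, x.unop.1 i - y.unop.1 i = a i + b i := fun i => congrFun hab i
    have hz : y.unop.1 + a ≤ x.unop.1 := fun i => by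
      have := hp i
      have := hab' i
      simp only [Pi.add_apply]
      omega
    have hy : y.unop.1 ≤ y.unop.1 + a := fun i => by simp
    refine ⟨⟨Opposite.op ⟨y.unop.1 + a, Set.mem_Iic.2 (hz.trans x.unop.2)⟩,
      (homOfLE (show y.unop ≤ ⟨y.unop.1 + a, _⟩ from hy)).op,
      (homOfLE (show (⟨y.unop.1 + a, Set.mem_Iic.2 (hz.trans x.unop.2)⟩ : Set.Iic m) ≤ x.unop
        from hz)).op⟩, ⟨?_, ?_, Subsingleton.elim _ _⟩, ?_⟩
    · simp
    · funext i
      have := hp i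
      have := hab' i
      simp only [Pi.sub_apply, Pi.add_apply]
      omega
    · rintro ⟨z, f, g⟩ ⟨hf, -, -⟩
      have h : z = Opposite.op ⟨y.unop.1 + a, Set.mem_Iic.2 (hz.trans x.unop.2)⟩ := by
        refine Opposite.unop_injective (Subtype.ext ?_)
        funext i
        have h1 : y.unop.1 i ≤ z.unop.1 i := leOfHom f.unop i
        have h2 : z.unop.1 i - y.unop.1 i = a i := congrFun hf i
        simp only [Pi.add_apply]
        omega
      subst h
      exact Sigma.ext rfl (heq_of_eq (Prod.ext (Subsingleton.elim _ _) (Subsingleton.elim _ _)))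

/-- The `r`-graph `Ω_{r, (1, …, 1)}`. -/
abbrev Cube (r : ℕ) : KGraph.{0, 0} r := Omega (1 : Fin r → ℕ)

/-- The path `(0, (1, …, 1))` of the cube. -/
def cubeTop (r : ℕ) : (Cube r).Path :=
  ⟨Opposite.op ⟨1, Set.mem_Iic.2 le_rfl⟩, Opposite.op ⟨0, Set.mem_Iic.2 zero_le_one⟩,
    (homOfLE (show (⟨0, _⟩ : Set.Iic (1 : Fin r → ℕ)) ≤ ⟨1, _⟩ from
      Subtype.mk_le_mk.2 zero_le_one)).op⟩

theorem coface_mono {r : ℕ} (i : Fin (r + 1)) (l : Fin 2) :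
    Monotone (coface (α := ℕ) i l) := by
  intro a b hab q
  rcases Fin.eq_self_or_eq_succAbove i q with rfl | ⟨q, rfl⟩
  · rw [coface_same, coface_same]
  · rw [coface_succAbove, coface_succAbove]
    exact hab q

theorem coface_le_one {r : ℕ} (i : Fin (r + 1)) (l : Fin 2) (a : Fin r → ℕ) (ha : a ≤ 1) :
    coface i l a ≤ 1 := by
  intro q
  rcases Fin.eq_self_or_eq_succAbove i q with rfl | ⟨q, rfl⟩
  · rw [coface_same]
    split_ifs <;> simp
  · rw [coface_succAbove]
    exact ha q

/-- The quasimorphism `Cube r → Cube (r + 1)` that sends `(p, q)` to `(ε p, ε q)`. -/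
def cofaceFunctor {r : ℕ} (i : Fin (r + 1)) (l : Fin 2) : (Cube r).Obj ⥤ (Cube (r + 1)).Obj :=
  (Monotone.functor (f := fun a : Set.Iic (1 : Fin r → ℕ) =>
    (⟨coface i l a.1, Set.mem_Iic.2 (coface_le_one i l a.1 a.2)⟩ : Set.Iic (1 : Fin (r + 1) → ℕ)))
    (fun _ _ h => coface_mono i l h)).op

/-- The quasimorphism `Cube (r + 1) → Cube r` that sends `(p, q)` to `(η p, η q)`. -/
def codegenFunctor {r : ℕ} (i : Fin (r + 1)) : (Cube (r + 1)).Obj ⥤ (Cube r).Obj :=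
  (Monotone.functor (f := fun a : Set.Iic (1 : Fin (r + 1) → ℕ) =>
    (⟨codegen i a.1, Set.mem_Iic.2 fun q => a.2 (i.succAbove q)⟩ : Set.Iic (1 : Fin r → ℕ)))
    (fun a b h q => (show a.1 ≤ b.1 from h) (i.succAbove q))).op

theorem cubeFunctor_ext {r s : ℕ} {F G : (Cube r).Obj ⥤ (Cube s).Obj}
    (h : ∀ a, (F.obj a).unop.1 = (G.obj a).unop.1) : F = G :=
  CategoryTheory.Functor.ext (fun a => Opposite.unop_injective (Subtype.ext (h a)))
    (fun _ _ _ => Subsingleton.elim _ _)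

/-! ## Admissible maps and the cubical set of a `k`-graph -/

/-- A homomorphism `h : ℕ ^ r → ℕ ^ k` is admissible (of rank `t`) if there are `i_1 < ⋯ < i_t` and
`j_1 < ⋯ < j_t` with `h e_{i_p} = e_{j_p}` for all `p`, and `h e_i = 0` for every other `i`. -/
def IsAdmissible {r k : ℕ} (h : (Fin r → ℕ) →+ (Fin k → ℕ)) : Prop :=
  ∃ (t : ℕ) (i : Fin t ↪o Fin r) (j : Fin t ↪o Fin k),
    (∀ p, h (Pi.single (i p) 1) = Pi.single (j p) 1) ∧
      ∀ q, q ∉ Set.range i → h (Pi.single q 1) = 0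

theorem single_one_inj {k : ℕ} {a b : Fin k} (h : (Pi.single a 1 : Fin k → ℕ) = Pi.single b 1) :
    a = b := by
  by_contra hne
  have := congrFun h a
  simp [hne] at this

theorem isAdmissible_iff {r k : ℕ} (h : (Fin r → ℕ) →+ (Fin k → ℕ)) :
    IsAdmissible h ↔ (∀ q, h (Pi.single q 1) = 0 ∨ ∃ a, h (Pi.single q 1) = Pi.single a 1) ∧
      ∀ q q' a a', q < q' → h (Pi.single q 1) = Pi.single a 1 →
        h (Pi.single q' 1) = Pi.single a' 1 → a < a' := by
  have hne : ∀ a : Fin k, (0 : Fin k → ℕ) ≠ Pi.single a 1 := fun a h0 => by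
    have := congrFun h0 a
    simp at this
  constructor
  · rintro ⟨t, i, j, hij, h0⟩
    refine ⟨fun q => ?_, fun q q' a a' hq ha ha' => ?_⟩
    · by_cases hq : q ∈ Set.range i
      · obtain ⟨p, rfl⟩ := hq
        exact Or.inr ⟨_, hij p⟩
      · exact Or.inl (h0 q hq)
    · have hr : ∀ q a, h (Pi.single q 1) = Pi.single a 1 → ∃ p, i p = q ∧ j p = a := by
        intro q a ha
        by_cases hq : q ∈ Set.range i
        · obtain ⟨p, rfl⟩ := hq
          exact ⟨p, rfl, single_one_inj ((hij p).symm.trans ha)⟩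
        · exact absurd ((h0 q hq).symm.trans ha) (hne a)
      obtain ⟨p, rfl, rfl⟩ := hr q a ha
      obtain ⟨p', rfl, rfl⟩ := hr q' a' ha'
      exact j.lt_iff_lt.2 (i.lt_iff_lt.1 hq)
  · classical
    rintro ⟨h1, h2⟩
    let s : Finset (Fin r) := Finset.univ.filter fun q => h (Pi.single q 1) ≠ 0
    let i : Fin s.card ↪o Fin r := s.orderEmbOfFin rfl
    have hi : ∀ p, ∃ a, h (Pi.single (i p) 1) = Pi.single a 1 := fun p => by
      have : i p ∈ s := s.orderEmbOfFin_mem rfl p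
      exact (h1 _).resolve_left (Finset.mem_filter.1 this).2
    choose j hj using hi
    refine ⟨s.card, i, OrderEmbedding.ofStrictMono j fun p p' hp =>
      h2 _ _ _ _ (i.lt_iff_lt.2 hp) (hj p) (hj p'), hj, fun q hq => ?_⟩
    by_contra hq'
    refine hq ?_
    rw [Finset.range_orderEmbOfFin]
    simpa [s] using hq'

/-- Insertion of the coordinate `0`, as a homomorphism. -/
def insertZero {r : ℕ} (i : Fin (r + 1)) : (Fin r → ℕ) →+ (Fin (r + 1) → ℕ) where
  toFun := coface i 0
  map_zero' := by
    symm
    rw [eq_coface_iff]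
    simp
  map_add' a b := by
    symm
    rw [eq_coface_iff]
    refine ⟨?_, fun q => ?_⟩
    · simp only [Pi.add_apply, coface_same]
      simp
    · simp only [Pi.add_apply, coface_succAbove]

/-- Deletion of a coordinate, as a homomorphism. -/
def deleteCoord {r : ℕ} (i : Fin (r + 1)) : (Fin (r + 1) → ℕ) →+ (Fin r → ℕ) where
  toFun := codegen i
  map_zero' := rfl
  map_add' _ _ := rfl

theorem insertZero_single {r : ℕ} (i : Fin (r + 1)) (q : Fin r) :
    insertZero i (Pi.single q 1) = Pi.single (i.succAbove q) 1 := by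
  symm
  change _ = coface i 0 _
  rw [eq_coface_iff]
  refine ⟨?_, fun q' => ?_⟩
  · simp [(Fin.succAbove_ne i q).symm]
  · simp [Pi.single_apply]

theorem deleteCoord_single_same {r : ℕ} (i : Fin (r + 1)) :
    deleteCoord i (Pi.single i 1) = 0 := by
  funext q
  change (Pi.single i 1 : Fin (r + 1) → ℕ) (i.succAbove q) = 0
  simp

theorem deleteCoord_single_succAbove {r : ℕ} (i : Fin (r + 1)) (q : Fin r) :
    deleteCoord i (Pi.single (i.succAbove q) 1) = Pi.single q 1 := by
  funext q'
  change (Pi.single (i.succAbove q) 1 : Fin (r + 1) → ℕ) (i.succAbove q') = _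
  simp [Pi.single_apply]

theorem IsAdmissible.face {r k : ℕ} {h : (Fin (r + 1) → ℕ) →+ (Fin k → ℕ)} (hh : IsAdmissible h)
    (i : Fin (r + 1)) : IsAdmissible (h.comp (insertZero i)) := by
  rw [isAdmissible_iff] at hh ⊢
  simp only [AddMonoidHom.comp_apply, insertZero_single]
  exact ⟨fun q => hh.1 _, fun q q' a a' hq => hh.2 _ _ a a' (Fin.succAbove_lt_succAbove_iff.2 hq)⟩

theorem IsAdmissible.degen {r k : ℕ} {h : (Fin r → ℕ) →+ (Fin k → ℕ)} (hh : IsAdmissible h)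
    (i : Fin (r + 1)) : IsAdmissible (h.comp (deleteCoord i)) := by
  have hne : ∀ a : Fin k, (0 : Fin k → ℕ) ≠ Pi.single a 1 := fun a h0 => by
    have := congrFun h0 a
    simp at this
  rw [isAdmissible_iff] at hh ⊢
  simp only [AddMonoidHom.comp_apply]
  refine ⟨fun q => ?_, fun q q' a a' hq ha ha' => ?_⟩
  · rcases Fin.eq_self_or_eq_succAbove i q with rfl | ⟨q, rfl⟩
    · rw [deleteCoord_single_same, map_zero]
      exact Or.inl rfl
    · rw [deleteCoord_single_succAbove]
      exact hh.1 q
  · rcases Fin.eq_self_or_eq_succAbove i q with rfl | ⟨q, rfl⟩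
    · rw [deleteCoord_single_same, map_zero] at ha
      exact absurd ha (hne a)
    rcases Fin.eq_self_or_eq_succAbove i q' with rfl | ⟨q', rfl⟩
    · rw [deleteCoord_single_same, map_zero] at ha'
      exact absurd ha' (hne a')
    rw [deleteCoord_single_succAbove] at ha ha'
    exact hh.2 _ _ a a' (Fin.succAbove_lt_succAbove_iff.1 hq) ha ha'

namespace KGraph

variable {k : ℕ}

/-- An `r`-cube of `Γ`: a quasimorphism `φ : Cube r → Γ`, i.e. a functor with `d ∘ φ = h ∘ d` for a
homomorphism `h`, such that `h` is admissible. -/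
def RCube (Γ : KGraph.{u, v} k) (r : ℕ) : Type (max u v) :=
  {φ : (Cube r).Obj ⥤ Γ.Obj // ∃ h : (Fin r → ℕ) →+ (Fin k → ℕ), IsAdmissible h ∧
    ∀ {a b : (Cube r).Obj} (f : a ⟶ b), Γ.degree (φ.map f) = h ((Cube r).degree f)}

/-- The face `φ ∘ ε`. -/
def RCube.face {Γ : KGraph.{u, v} k} {r : ℕ} (i : Fin (r + 1)) (l : Fin 2)
    (φ : Γ.RCube (r + 1)) : Γ.RCube r :=
  ⟨cofaceFunctor i l ⋙ φ.1, by
    obtain ⟨h, hh, hφ⟩ := φ.2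
    refine ⟨h.comp (insertZero i), hh.face i, fun {a b} f => ?_⟩
    rw [Functor.comp_map, hφ, AddMonoidHom.comp_apply]
    congr 1
    change coface i l a.unop.1 - coface i l b.unop.1 = coface i 0 (a.unop.1 - b.unop.1)
    rw [eq_coface_iff]
    refine ⟨?_, fun q => ?_⟩
    · simp only [Pi.sub_apply, coface_same]
      simp
    · simp only [Pi.sub_apply, coface_succAbove]⟩

/-- The degeneracy `φ ∘ η`. -/
def RCube.degen {Γ : KGraph.{u, v} k} {r : ℕ} (i : Fin (r + 1))
    (φ : Γ.RCube r) : Γ.RCube (r + 1) :=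
  ⟨codegenFunctor i ⋙ φ.1, by
    obtain ⟨h, hh, hφ⟩ := φ.2
    refine ⟨h.comp (deleteCoord i), hh.degen i, fun {a b} f => ?_⟩
    rw [Functor.comp_map, hφ, AddMonoidHom.comp_apply]
    rfl⟩

/-- The cubical set `Q̃(Γ)` of a `k`-graph `Γ`. -/
def cubicalSet (Γ : KGraph.{u, v} k) : CubicalSet.{max u v} where
  cubes := Γ.RCube
  face := RCube.face
  degen := RCube.degen
  face_face i j l m φ hji := Subtype.ext
    (congrArg (· ⋙ φ.1) (cubeFunctor_ext (F := cofaceFunctor i l ⋙ cofaceFunctor j.castSucc m)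
      (G := cofaceFunctor j m ⋙ cofaceFunctor i.succ l)
      fun a => coface_coface i j l m a.unop.1 hji))
  degen_degen i j φ hji := Subtype.ext
    (congrArg (· ⋙ φ.1) (cubeFunctor_ext (F := codegenFunctor j.castSucc ⋙ codegenFunctor i)
      (G := codegenFunctor i.succ ⋙ codegenFunctor j)
      fun a => codegen_codegen i j a.unop.1 hji))
  face_degen_of_lt i j l φ hji := Subtype.ext
    (congrArg (· ⋙ φ.1) (cubeFunctor_ext (F := cofaceFunctor i.succ l ⋙ codegenFunctor j.castSucc)
      (G := codegenFunctor j ⋙ cofaceFunctor i l)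
      fun a => codegen_coface_of_lt i j l a.unop.1 hji))
  face_degen_self i l φ := Subtype.ext
    (congrArg (· ⋙ φ.1) (cubeFunctor_ext (F := cofaceFunctor i l ⋙ codegenFunctor i)
      (G := 𝟭 _) fun a => codegen_coface i l a.unop.1))
  face_degen_of_gt i j l φ hij := Subtype.ext
    (congrArg (· ⋙ φ.1) (cubeFunctor_ext (F := cofaceFunctor i.castSucc l ⋙ codegenFunctor j.succ)
      (G := codegenFunctor j ⋙ cofaceFunctor i l)
      fun a => codegen_coface_of_gt i j l a.unop.1 hij))

/-- The admissible map that is associated to an `r`-cube; it is unique, see `admissible_unique`. -/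
noncomputable def RCube.admissible {Γ : KGraph.{u, v} k} {r : ℕ} (φ : Γ.RCube r) :
    (Fin r → ℕ) →+ (Fin k → ℕ) :=
  Classical.choose φ.2

theorem RCube.admissible_degree {Γ : KGraph.{u, v} k} {r : ℕ} (φ : Γ.RCube r)
    {a b : (Cube r).Obj} (f : a ⟶ b) :
    Γ.degree (φ.1.map f) = φ.admissible ((Cube r).degree f) :=
  (Classical.choose_spec φ.2).2 f

theorem RCube.admissible_unique {Γ : KGraph.{u, v} k} {r : ℕ} (φ : Γ.RCube r)
    (h : (Fin r → ℕ) →+ (Fin k → ℕ))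
    (hφ : ∀ {a b : (Cube r).Obj} (f : a ⟶ b), Γ.degree (φ.1.map f) = h ((Cube r).degree f)) :
    h = φ.admissible := by
  refine AddMonoidHom.functions_ext _ _ _ fun i x => ?_
  have h1 : h (Pi.single i 1) = φ.admissible (Pi.single i 1) := by
    have hle : (Pi.single i 1 : Fin r → ℕ) ≤ 1 := by
      intro q
      by_cases hq : q = i
      · subst hq
        simp
      · simp [hq]
    let f : (Opposite.op ⟨Pi.single i 1, Set.mem_Iic.2 hle⟩ : (Cube r).Obj) ⟶
        Opposite.op ⟨0, Set.mem_Iic.2 zero_le_one⟩ :=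
      (homOfLE (show (⟨0, _⟩ : Set.Iic (1 : Fin r → ℕ)) ≤ ⟨Pi.single i 1, _⟩
        from fun q => Nat.zero_le _)).op
    exact (hφ f).symm.trans (φ.admissible_degree f)
  have hx : (Pi.single i x : Fin r → ℕ) = x • Pi.single i 1 := by
    funext q
    by_cases hq : q = i
    · subst hq
      simp
    · simp [hq]
  rw [hx, map_nsmul, map_nsmul, h1]

/-- The path `φ(0, (1, …, 1))` of an `r`-cube `φ`. -/
def RCube.top {Γ : KGraph.{u, v} k} {r : ℕ} (φ : Γ.RCube r) : Γ.Path :=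
  ⟨_, _, φ.1.map (cubeTop r).hom⟩

/-- The real extension `h(t) = ∑ i, t_i h(e_i)` of the associated admissible map. -/
noncomputable def RCube.realMap {Γ : KGraph.{u, v} k} {r : ℕ} (φ : Γ.RCube r) (t : Fin r → ℝ) :
    Fin k → ℝ :=
  fun a => ∑ i, t i * (φ.admissible (Pi.single i 1) a : ℝ)

theorem RCube.realMap_mem {Γ : KGraph.{u, v} k} {r : ℕ} (φ : Γ.RCube r)
    (t : Fin r → unitInterval) :
    φ.realMap (fun i => (t i : ℝ)) ∈ Set.Icc (0 : Fin k → ℝ) (fun i => (Γ.d φ.top i : ℝ)) := by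
  have hd : Γ.d φ.top = ∑ i, φ.admissible (Pi.single i 1) := by
    rw [← map_sum]
    refine (φ.admissible_degree (cubeTop r).hom).trans (congrArg _ ?_)
    funext q
    simp [cubeTop, Finset.sum_apply, Pi.single_apply]
  refine ⟨fun a => ?_, fun a => ?_⟩
  · exact Finset.sum_nonneg fun i _ => mul_nonneg (t i).2.1 (Nat.cast_nonneg _)
  · simp only [hd, Finset.sum_apply, Nat.cast_sum]
    exact Finset.sum_le_sum fun i _ => mul_le_of_le_one_left (Nat.cast_nonneg _) (t i).2.2

/-- The map `φ̃ : [0,1] ^ r → X_Γ`, `φ̃(t) = [φ(0, (1, …, 1)), h(t)]`, of an `r`-cube `φ`. -/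
noncomputable def RCube.tilde {Γ : KGraph.{u, v} k} {r : ℕ} (φ : Γ.RCube r)
    (t : Fin r → unitInterval) : Γ.Realisation :=
  Γ.toRealisation ⟨φ.top, φ.realMap (fun i => (t i : ℝ)), φ.realMap_mem t⟩

end KGraph

namespace KGraph

variable {k : ℕ} {Γ : KGraph.{u, v} k}

/-! ### Segments of paths -/

/-! The map `π` exists and is unique by the universal property of the realisation once the maps
`tilde` respect faces and degeneracies. They do because the top path of a face or degeneracy of `φ`
is a segment of the top path of `φ`, and `[p, t]` is unchanged when `p` is replaced by a segment
containing `t` and `t` is shifted by the integral starting degree (`toRealisation_eq_of_isSegment`).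

The inverse is explicit. The part of a path `p` in the unit box with corner `m` is a `k`-cube
`cubeAt p m`; corners are truncated at `d p`, so it is constant in the directions in which `p` ends.
A point `(p, t)` goes to the point with coordinates `t - ⌊t⌋` in the `k`-cube of the path `p(⌊t⌋,
⌈t⌉)`. This uses only the two data that define the equivalence relation of `X_Γ`, so it descends to
the quotient.

Everything else rests on `hat_substCoords`: if `ψ` arises from `φ` by substituting constants and
variables in increasing order, then the points of `ψ` are identified with the substituted points of
`φ`. It gives `cubePoint_eq_hat`: every unit box containing `t` yields the same point. Hence the
inverse is continuous, by gluing over finitely many closed boxes. It also gives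
`ofRealisation_tilde`, since an admissible map is itself such a substitution. The other composite is
`tilde_cubeAt_cell`. -/

theorem comp_right_cancel {x y z : Γ.Obj} {f f' : x ⟶ y} {g : y ⟶ z} (h : f ≫ g = f' ≫ g) :
    f = f' := by
  have hd : Γ.degree f' = Γ.degree f := by
    have := congrArg Γ.degree h
    rw [Γ.degree_comp, Γ.degree_comp] at this
    exact (add_right_cancel this).symm
  have e := (Γ.factorisation (f ≫ g) (Γ.degree g) (Γ.degree f)
    (by rw [Γ.degree_comp, add_comm])).unique (y₁ := ⟨y, g, f⟩) (y₂ := ⟨y, g, f'⟩)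
    ⟨rfl, rfl, rfl⟩ ⟨rfl, hd, h.symm⟩
  simpa using e

/-- Split off from `a` its initial part of degree `d a'`. This part and `a'` begin factorisations of
the same path with the same degrees, so uniqueness identifies them. -/
theorem exists_comp_eq {x y z w : Γ.Obj} (a : z ⟶ y) (c : x ⟶ z) (a' : w ⟶ y) (c' : x ⟶ w)
    (h : c ≫ a = c' ≫ a') (hd : Γ.degree a' ≤ Γ.degree a) : ∃ b : z ⟶ w, b ≫ a' = a := by
  obtain ⟨⟨w₁, a₁, b⟩, ⟨ha, -, hab⟩, -⟩ := Γ.factorisation a (Γ.degree a') _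
    (add_tsub_cancel_of_le hd).symm
  simp only at ha hab
  have hd' := congrArg Γ.degree h
  rw [← hab, ← Category.assoc, Γ.degree_comp (c ≫ b), Γ.degree_comp c', ha] at hd'
  have e := (Γ.factorisation (c' ≫ a') (Γ.degree a') (Γ.degree c')
    (by rw [Γ.degree_comp, add_comm])).unique (y₁ := ⟨w₁, a₁, c ≫ b⟩) (y₂ := ⟨w, a', c'⟩)
    ⟨ha, add_right_cancel hd', by simp [hab, h]⟩ ⟨rfl, rfl, rfl⟩
  obtain ⟨rfl, e⟩ := Sigma.mk.inj e
  obtain ⟨rfl, -⟩ := Prod.mk.inj (eq_of_heq e)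
  exact ⟨b, hab⟩

/-- The path `b` is the segment `p(m, n)` of `p`. -/
def IsSegment (p : Γ.Path) (m n : Fin k → ℕ) (b : Γ.Path) : Prop :=
  ∃ (a : b.right ⟶ p.right) (c : p.left ⟶ b.left),
    Γ.degree a = m ∧ Γ.degree b.hom = n - m ∧ Γ.degree c = Γ.d p - n ∧ c ≫ b.hom ≫ a = p.hom

theorem isSegment_segment (p : Γ.Path) (m n : Fin k → ℕ) (hmn : m ≤ n) (hn : n ≤ Γ.d p) :
    IsSegment p m n (Γ.segment p m n hmn hn) :=
  (Classical.choose_spec (Γ.existsUnique_segment p m n hmn hn)).1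

theorem IsSegment.unique {p b b' : Γ.Path} {m n : Fin k → ℕ} (h : IsSegment p m n b)
    (h' : IsSegment p m n b') (hmn : m ≤ n) (hn : n ≤ Γ.d p) : b = b' :=
  (Γ.existsUnique_segment p m n hmn hn).unique h h'

theorem IsSegment.degree_eq {p b : Γ.Path} {m n : Fin k → ℕ} (h : IsSegment p m n b) :
    Γ.d b = n - m :=
  h.choose_spec.choose_spec.2.1

theorem IsSegment.trans {p b b' : Γ.Path} {m n m' n' : Fin k → ℕ} (h : IsSegment p m n b)
    (h' : IsSegment b m' n' b') (hmn : m ≤ n) (hn : n ≤ Γ.d p) (hn' : n' ≤ Γ.d b) :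
    IsSegment p (m + m') (m + n') b' := by
  have hd := h.degree_eq
  obtain ⟨a, c, ha, hb, hc, e⟩ := h
  obtain ⟨a', c', ha', hb', hc', e'⟩ := h'
  refine ⟨a' ≫ a, c ≫ c', by rw [Γ.degree_comp, ha, ha', add_comm], ?_, ?_, ?_⟩
  · rw [hb', add_tsub_add_eq_tsub_left]
  · rw [Γ.degree_comp, hc, hc']
    funext i
    have h1 := hmn i
    have h2 := hn i
    have h3 := hn' i
    have h4 := congrFun hd i
    simp only [Pi.sub_apply, Pi.add_apply] at *
    omega
  · rw [← e, ← e']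
    simp only [Category.assoc]

theorem exists_initialPart (p : Γ.Path) (x : (Omega (Γ.d p)).Obj) :
    ∃ q : Σ z : Γ.Obj, (z ⟶ p.right) × (p.left ⟶ z),
      Γ.degree q.2.1 = x.unop.1 ∧ Γ.degree q.2.2 = Γ.d p - x.unop.1 ∧ q.2.2 ≫ q.2.1 = p.hom :=
  (Γ.factorisation p.hom x.unop.1 (Γ.d p - x.unop.1) (add_tsub_cancel_of_le x.unop.2).symm).exists

/-- The factorisation of `p` into a path of the given degree and a remainder. -/
noncomputable def initialPart (p : Γ.Path) (x : (Omega (Γ.d p)).Obj) :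
    Σ z : Γ.Obj, (z ⟶ p.right) × (p.left ⟶ z) :=
  (exists_initialPart p x).choose

theorem initialPart_spec (p : Γ.Path) (x : (Omega (Γ.d p)).Obj) :
    Γ.degree (initialPart p x).2.1 = x.unop.1 ∧
      Γ.degree (initialPart p x).2.2 = Γ.d p - x.unop.1 ∧
      (initialPart p x).2.2 ≫ (initialPart p x).2.1 = p.hom :=
  (exists_initialPart p x).choose_spec

theorem exists_segmentMap (p : Γ.Path) {x y : (Omega (Γ.d p)).Obj} (f : x ⟶ y) :
    ∃ b : (initialPart p x).1 ⟶ (initialPart p y).1,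
      b ≫ (initialPart p y).2.1 = (initialPart p x).2.1 := by
  obtain ⟨h1, -, h2⟩ := initialPart_spec p x
  obtain ⟨h1', -, h2'⟩ := initialPart_spec p y
  refine exists_comp_eq _ _ _ _ (h2.trans h2'.symm) ?_
  rw [h1, h1']
  exact leOfHom f.unop

/-- The functor `Ω_{k, d p} ⥤ Γ` with `(m, n) ↦ p(m, n)`. -/
noncomputable def segmentFunctor (p : Γ.Path) : (Omega (Γ.d p)).Obj ⥤ Γ.Obj where
  obj x := (initialPart p x).1
  map f := (exists_segmentMap p f).choose
  -- A chosen segment is pinned down by its composite with the initial part of its range, so both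
  -- functor laws follow by cancellation.
  map_id x := comp_right_cancel (g := (initialPart p x).2.1) (by
    rw [(exists_segmentMap p (𝟙 x)).choose_spec, Category.id_comp])
  map_comp {x y z} f g := comp_right_cancel (g := (initialPart p z).2.1) (by
    rw [(exists_segmentMap p (f ≫ g)).choose_spec, Category.assoc,
      (exists_segmentMap p g).choose_spec, (exists_segmentMap p f).choose_spec])

theorem segmentFunctor_map_comp (p : Γ.Path) {x y : (Omega (Γ.d p)).Obj} (f : x ⟶ y) :
    (segmentFunctor p).map f ≫ (initialPart p y).2.1 = (initialPart p x).2.1 :=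
  (exists_segmentMap p f).choose_spec

theorem degree_segmentFunctor_map (p : Γ.Path) {x y : (Omega (Γ.d p)).Obj} (f : x ⟶ y) :
    Γ.degree ((segmentFunctor p).map f) = x.unop.1 - y.unop.1 := by
  have h : Γ.degree ((segmentFunctor p).map f) + y.unop.1 = x.unop.1 :=
    (congrArg (Γ.degree ((segmentFunctor p).map f) + ·) (initialPart_spec p y).1.symm).trans
      ((Γ.degree_comp _ _).symm.trans
        ((congrArg Γ.degree (segmentFunctor_map_comp p f)).trans (initialPart_spec p x).1))
  rw [← h, add_tsub_cancel_right]

theorem isSegment_segmentFunctor (p : Γ.Path) {x y : (Omega (Γ.d p)).Obj} (f : x ⟶ y) :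
    IsSegment p y.unop.1 x.unop.1 ⟨_, _, (segmentFunctor p).map f⟩ := by
  refine ⟨(initialPart p y).2.1, (initialPart p x).2.2, (initialPart_spec p y).1,
    degree_segmentFunctor_map p f, (initialPart_spec p x).2.1, ?_⟩
  refine (congrArg _ (segmentFunctor_map_comp p f)).trans (initialPart_spec p x).2.2

/-! ### Points of the realisation -/

/-- Floor and ceiling commute with the integral shift `m`. The offsets therefore agree, and the cell
of `y`, as a segment of a segment, is the segment of `x.1` that defines the cell of `x`. -/
theorem toRealisation_eq_of_isSegment {x y : Γ.Point} {m n : Fin k → ℕ} (hmn : m ≤ n)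
    (hn : n ≤ Γ.d x.1) (h : IsSegment x.1 m n y.1) (ht : ∀ i, x.2.1 i = m i + y.2.1 i) :
    Γ.toRealisation x = Γ.toRealisation y := by
  have h0 : ∀ i, 0 ≤ y.2.1 i := fun i => y.2.2.1 i
  have hf : ∀ i, ⌊x.2.1 i⌋₊ = m i + ⌊y.2.1 i⌋₊ := fun i => by
    rw [ht, add_comm, Nat.floor_add_natCast (h0 i), add_comm]
  have hc : ∀ i, ⌈x.2.1 i⌉₊ = m i + ⌈y.2.1 i⌉₊ := fun i => by
    rw [ht, add_comm, Nat.ceil_add_natCast (h0 i), add_comm]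
  refine Quotient.sound ⟨funext fun i => ?_, ?_⟩
  · simp only [offset, hf]
    rw [ht]
    push_cast
    ring
  · have h1 := isSegment_segment x.1 (fun i => ⌊x.2.1 i⌋₊) (fun i => ⌈x.2.1 i⌉₊)
      (fun _ => Nat.floor_le_ceil _) (fun i => Nat.ceil_le.2 (x.2.2.2 i))
    refine h1.unique ?_ (fun _ => Nat.floor_le_ceil _) (fun i => Nat.ceil_le.2 (x.2.2.2 i))
    have h2 := h.trans (isSegment_segment y.1 (fun i => ⌊y.2.1 i⌋₊) (fun i => ⌈y.2.1 i⌉₊)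
      (fun _ => Nat.floor_le_ceil _) (fun i => Nat.ceil_le.2 (y.2.2.2 i))) hmn hn
      (fun i => Nat.ceil_le.2 (y.2.2.2 i))
    simp only [hf, hc]
    exact h2

/-! ### Paths of a cube -/

/-- The path that a cube assigns to a path of `Cube r`. -/
def RCube.path {r : ℕ} (φ : Γ.RCube r) {a b : (Cube r).Obj} (f : a ⟶ b) : Γ.Path :=
  ⟨_, _, φ.1.map f⟩

theorem RCube.functor_ext {r : ℕ} {F G : (Cube r).Obj ⥤ Γ.Obj}
    (h : ∀ {a b : (Cube r).Obj} (f : a ⟶ b),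
      (⟨_, _, F.map f⟩ : Γ.Path) = ⟨_, _, G.map f⟩) : F = G := by
  refine CategoryTheory.Functor.hext (fun a => (Quiver.Total.mk.inj (h (𝟙 a))).1)
    fun a b f => (Quiver.Total.mk.inj (h f)).2.2

/-- In the poset `Cube r` the path `(0, 1)` factors through every `f`; applying `φ` gives the
required factorisation of `φ.top`. -/
theorem RCube.isSegment_path {r : ℕ} (φ : Γ.RCube r) {a b : (Cube r).Obj} (f : a ⟶ b) :
    IsSegment φ.top (φ.admissible b.unop.1) (φ.admissible a.unop.1) (φ.path f) := by
  have hab : b.unop.1 ≤ a.unop.1 := leOfHom f.unop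
  -- Truncated subtraction is respected by an additive map only on comparable pairs.
  have hsub : ∀ x y : Fin r → ℕ, x ≤ y →
      φ.admissible (y - x) = φ.admissible y - φ.admissible x := fun x y hxy => by
    rw [eq_tsub_iff_add_eq_of_le, ← map_add, tsub_add_cancel_of_le hxy]
    rw [← tsub_add_cancel_of_le hxy, map_add]
    exact le_add_self
  let g : b ⟶ (cubeTop r).right :=
    (homOfLE (show (cubeTop r).right.unop ≤ b.unop from fun q => Nat.zero_le _)).op
  let g' : (cubeTop r).left ⟶ a :=
    (homOfLE (show a.unop ≤ (cubeTop r).left.unop from a.unop.2)).op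
  refine ⟨φ.1.map g, φ.1.map g', ?_, ?_, ?_, ?_⟩
  · refine (φ.admissible_degree g).trans (congrArg _ ?_)
    exact tsub_zero b.unop.1
  · exact (φ.admissible_degree f).trans (hsub _ _ hab)
  · refine (φ.admissible_degree g').trans ((hsub _ _ a.unop.2).trans ?_)
    congr 1
    refine ((φ.admissible_degree (cubeTop r).hom).trans (congrArg _ ?_)).symm
    exact tsub_zero _
  · refine (congrArg _ (φ.1.map_comp _ _).symm).trans ((φ.1.map_comp _ _).symm.trans ?_)
    exact congrArg φ.1.map (Subsingleton.elim _ _)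

theorem RCube.d_top {r : ℕ} (φ : Γ.RCube r) : Γ.d φ.top = φ.admissible 1 :=
  (φ.admissible_degree (cubeTop r).hom).trans (congrArg _ (tsub_zero _))

theorem RCube.admissible_mono {r : ℕ} (φ : Γ.RCube r) : Monotone φ.admissible := fun x y h => by
  rw [← tsub_add_cancel_of_le h, map_add]
  exact le_add_self

theorem RCube.admissible_apply {r : ℕ} (φ : Γ.RCube r) (p : Fin r → ℕ) (a : Fin k) :
    φ.admissible p a = ∑ i, p i * φ.admissible (Pi.single i 1) a := by
  conv_lhs => rw [← Finset.univ_sum_single p]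
  rw [map_sum, Finset.sum_apply]
  refine Finset.sum_congr rfl fun i _ => ?_
  have hx : (Pi.single i (p i) : Fin r → ℕ) = p i • Pi.single i 1 := by
    funext q
    by_cases hq : q = i
    · subst hq
      simp
    · simp [hq]
  rw [hx, map_nsmul]
  simp

theorem RCube.admissible_face {r : ℕ} (φ : Γ.RCube (r + 1)) (i : Fin (r + 1)) (l : Fin 2) :
    (φ.face i l).admissible = φ.admissible.comp (insertZero i) := by
  symm
  refine (φ.face i l).admissible_unique _ fun {a b} f => ?_
  refine (φ.admissible_degree ((cofaceFunctor i l).map f)).trans ?_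
  rw [AddMonoidHom.comp_apply]
  congr 1
  change coface i l a.unop.1 - coface i l b.unop.1 = coface i 0 (a.unop.1 - b.unop.1)
  rw [eq_coface_iff]
  refine ⟨by simp [coface_same], fun q => by simp only [Pi.sub_apply, coface_succAbove]⟩

theorem RCube.admissible_degen {r : ℕ} (φ : Γ.RCube r) (i : Fin (r + 1)) :
    (φ.degen i).admissible = φ.admissible.comp (deleteCoord i) := by
  symm
  refine (φ.degen i).admissible_unique _ fun {a b} f => ?_
  exact φ.admissible_degree ((codegenFunctor i).map f)

/-! ### The comparison map -/

theorem RCube.continuous_tilde {r : ℕ} (φ : Γ.RCube r) : Continuous φ.tilde := by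
  refine continuous_quot_mk.comp (continuous_sigmaMk.comp (Continuous.subtype_mk ?_ _))
  unfold RCube.realMap
  fun_prop

/-- The integral shift is the degree `h(ε 0)` of the initial corner of the face: the contribution of
the inserted coordinate. -/
theorem RCube.tilde_coface {r : ℕ} (φ : Γ.RCube (r + 1)) (i : Fin (r + 1)) (l : Fin 2)
    (t : Fin r → unitInterval) : φ.tilde (coface i l t) = (φ.face i l).tilde t := by
  have h := φ.isSegment_path ((cofaceFunctor i l).map (cubeTop r).hom)
  refine toRealisation_eq_of_isSegment (φ.admissible_mono (leOfHom
    ((cofaceFunctor i l).map (cubeTop r).hom).unop)) ?_ h fun a => ?_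
  · exact (φ.admissible_mono (coface_le_one i l _ le_rfl)).trans φ.d_top.ge
  · change φ.realMap _ a = (φ.admissible (coface i l 0) a : ℝ) + (φ.face i l).realMap _ a
    rw [φ.admissible_apply]
    simp only [RCube.realMap, Fin.sum_univ_succAbove _ i, coface_same, coface_succAbove,
      RCube.admissible_face, AddMonoidHom.comp_apply, insertZero_single]
    congr 1
    split_ifs <;> simp

/-- Here the segment is the whole top path and the shift is zero; the deleted coordinate has `h(e_i)
= 0`. -/
theorem RCube.tilde_codegen {r : ℕ} (φ : Γ.RCube r) (i : Fin (r + 1))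
    (t : Fin (r + 1) → unitInterval) : φ.tilde (codegen i t) = (φ.degen i).tilde t := by
  have h := φ.isSegment_path ((codegenFunctor i).map (cubeTop (r + 1)).hom)
  refine toRealisation_eq_of_isSegment (φ.admissible_mono (leOfHom
    ((codegenFunctor i).map (cubeTop (r + 1)).hom).unop)) φ.d_top.ge h fun a => ?_
  change φ.realMap _ a = (φ.admissible 0 a : ℝ) + (φ.degen i).realMap _ a
  simp only [RCube.realMap, Fin.sum_univ_succAbove _ i, RCube.admissible_degen,
    AddMonoidHom.comp_apply, deleteCoord_single_succAbove, deleteCoord_single_same, map_zero,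
    Pi.zero_apply, Nat.cast_zero, mul_zero, zero_add]
  rfl

end KGraph

/-! ### Substitution maps between cubes -/

/-- The map `α ^ r → α ^ s` whose coordinates are the constants `0`, `1` and the coordinates of the
argument that `c` prescribes. -/
def substCoords {α : Type*} [Zero α] [One α] {r s : ℕ} (c : Fin s → Fin 2 ⊕ Fin r)
    (t : Fin r → α) : Fin s → α :=
  fun j => Sum.elim (fun l => if l = 0 then 0 else 1) t (c j)

theorem substCoords_mono {r s : ℕ} (c : Fin s → Fin 2 ⊕ Fin r) :
    Monotone (substCoords (α := ℕ) c) := by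
  intro a b hab j
  unfold substCoords
  rcases c j with l | i
  · exact le_rfl
  · exact hab i

theorem substCoords_le_one {r s : ℕ} (c : Fin s → Fin 2 ⊕ Fin r) (a : Fin r → ℕ) (ha : a ≤ 1) :
    substCoords c a ≤ 1 := by
  intro j
  unfold substCoords
  rcases c j with l | i
  · simp only [Sum.elim_inl, Pi.one_apply]
    split_ifs <;> simp
  · exact ha i

/-- The functor between cubes that is induced by a substitution. -/
def substFunctor {r s : ℕ} (c : Fin s → Fin 2 ⊕ Fin r) : (Cube r).Obj ⥤ (Cube s).Obj :=
  (Monotone.functor (f := fun a : Set.Iic (1 : Fin r → ℕ) =>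
    (⟨substCoords c a.1, Set.mem_Iic.2 (substCoords_le_one c a.1 a.2)⟩ : Set.Iic (1 : Fin s → ℕ)))
    (fun _ _ h => substCoords_mono c h)).op

theorem substCoords_eq_coface {α : Type*} [Zero α] [One α] {r s : ℕ}
    (c : Fin (s + 1) → Fin 2 ⊕ Fin r) {j : Fin (s + 1)} {l : Fin 2} (hj : c j = Sum.inl l)
    (t : Fin r → α) : substCoords c t = coface j l (substCoords (c ∘ j.succAbove) t) := by
  rw [eq_coface_iff]
  exact ⟨by simp [substCoords, hj], fun _ => rfl⟩

theorem substCoords_inr {α : Type*} [Zero α] [One α] {r s : ℕ} {c : Fin s → Fin 2 ⊕ Fin r}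
    {e : Fin s → Fin r} (hc : ∀ j, c j = Sum.inr (e j)) (t : Fin r → α) :
    substCoords c t = t ∘ e := by
  funext j
  simp [substCoords, hc]

namespace KGraph

variable {k : ℕ} {Γ : KGraph.{u, v} k}

/-- Such a substitution is a composite of cofaces and codegeneracies, removed one at a time by
induction on `r + s`. The order condition excludes permutations and diagonals, which faces and
degeneracies cannot produce. -/
theorem hat_substCoords (n : ℕ) : ∀ {r s : ℕ} (_ : r + s = n) (c : Fin s → Fin 2 ⊕ Fin r)
    (_ : ∀ j j' i i', j < j' → c j = Sum.inr i → c j' = Sum.inr i' → i < i')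
    (ψ : Γ.RCube r) (φ : Γ.RCube s) (_ : ψ.1 = substFunctor c ⋙ φ.1) (t : Fin r → unitInterval),
    Γ.cubicalSet.hat (r := r) ψ t = Γ.cubicalSet.hat (r := s) φ (substCoords c t) := by
  induction n using Nat.strong_induction_on with
  | _ n ih =>
    intro r s hn c hc ψ φ hψ t
    by_cases h1 : ∃ j l, c j = Sum.inl l
    -- A constant coordinate: pass from `φ` to its face there.
    · obtain ⟨j, l, hj⟩ := h1
      obtain _ | s := s
      · exact j.elim0
      rw [substCoords_eq_coface c hj]
      refine Eq.trans ?_ (Γ.cubicalSet.hat_face (r := s) j l φ _).symm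
      refine ih (r + s) (by omega) rfl (c ∘ j.succAbove)
        (fun q q' i i' hq => hc _ _ i i' (Fin.succAbove_lt_succAbove_iff.2 hq)) ψ (φ.face j l)
        (hψ.trans ?_) t
      exact congrArg (· ⋙ φ.1) (cubeFunctor_ext (F := substFunctor c)
        (G := substFunctor (c ∘ j.succAbove) ⋙ cofaceFunctor j l)
        fun a => substCoords_eq_coface c hj a.unop.1)
    · have h2 : ∀ j, ∃ i, c j = Sum.inr i := fun j => by
        rcases hj : c j with l | i
        · exact absurd ⟨j, l, hj⟩ h1
        · exact ⟨i, rfl⟩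
      choose e he using h2
      have hmono : StrictMono e := fun j j' hj => hc j j' _ _ hj (he j) (he j')
      -- With no constants, `c` is a strictly increasing map `e`. If surjective it is the identity;
      -- otherwise it misses some `q`, and `ψ` is degenerate in direction `q`.
      by_cases hs : Function.Surjective e
      · obtain rfl : s = r := by
          simpa using Fintype.card_of_bijective ⟨hmono.injective, hs⟩
        obtain rfl : e = id := (StrictMono.range_inj hmono strictMono_id).1 (by simp [hs.range_eq])
        have hid : substFunctor c = 𝟭 _ := cubeFunctor_ext fun a => substCoords_inr he a.unop.1
        rw [substCoords_inr he]
        obtain rfl : ψ = φ := Subtype.ext (by rw [hψ, hid]; rfl)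
        rfl
      · obtain ⟨q, hq⟩ := not_forall.1 hs
        obtain _ | r := r
        · exact q.elim0
        have h3 : ∀ j, ∃ i, e j = q.succAbove i := fun j =>
          (Fin.eq_self_or_eq_succAbove q (e j)).resolve_left fun h => hq ⟨j, h⟩
        choose e' he' using h3
        have hc' : ∀ j, (fun j => Sum.inr (e' j) : Fin s → Fin 2 ⊕ Fin r) j = Sum.inr (e' j) :=
          fun _ => rfl
        -- Stated for general `α` because it serves both the corners, over `ℕ`, and the points, over
        -- the unit interval.
        have key : ∀ {α : Type} [Zero α] [One α] (t : Fin (r + 1) → α),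
            substCoords c t = substCoords (fun j => Sum.inr (e' j)) (codegen q t) :=
          fun {α} _ _ t => by
            rw [substCoords_inr he, substCoords_inr hc']
            funext j
            simp only [Function.comp_apply, he']
            rfl
        have hdeg : ψ = (ψ.face q 0).degen q := by
          refine Subtype.ext ?_
          change ψ.1 = codegenFunctor q ⋙ cofaceFunctor q 0 ⋙ ψ.1
          rw [hψ]
          refine congrArg (· ⋙ φ.1) (cubeFunctor_ext (F := substFunctor c)
            (G := codegenFunctor q ⋙ cofaceFunctor q 0 ⋙ substFunctor c) fun a => ?_)
          change substCoords c a.unop.1 = substCoords c (coface q 0 (codegen q a.unop.1))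
          rw [key, key, codegen_coface]
        rw [key t]
        refine Eq.trans ?_ (ih (r + s) (by omega) rfl (fun j => Sum.inr (e' j)) ?_ (ψ.face q 0) φ
          ?_ (codegen q t))
        · refine (congrArg (fun x => Γ.cubicalSet.hat (r := r + 1) x t) hdeg).trans ?_
          exact (Γ.cubicalSet.hat_degen (r := r) q (ψ.face q 0) t).symm
        · intro j j' i i' hj hi hi'
          obtain rfl := Sum.inr.inj hi
          obtain rfl := Sum.inr.inj hi'
          have := hmono hj
          rw [he', he'] at this
          exact Fin.succAbove_lt_succAbove_iff.1 this
        · change cofaceFunctor q 0 ⋙ ψ.1 = _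
          rw [hψ]
          refine congrArg (· ⋙ φ.1) (cubeFunctor_ext (F := cofaceFunctor q 0 ⋙ substFunctor c)
            fun a => ?_)
          change substCoords c (coface q 0 a.unop.1) = _
          rw [key, codegen_coface]
          rfl

/-! ### The `k`-cubes of a path -/

/-- The functor `Cube k ⥤ Ω_{k, d p}` that sends `a` to `(m + a) ⊓ d p`. -/
def cubeAtFunctor (p : Γ.Path) (m : Fin k → ℕ) : (Cube k).Obj ⥤ (Omega (Γ.d p)).Obj :=
  (Monotone.functor (f := fun a : Set.Iic (1 : Fin k → ℕ) =>
    (⟨(m + a.1) ⊓ Γ.d p, Set.mem_Iic.2 inf_le_right⟩ : Set.Iic (Γ.d p)))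
    (fun a b h => inf_le_inf_right _ (add_le_add_right (show a.1 ≤ b.1 from h) m))).op

/-- The homomorphism that keeps the coordinates `i` with `m i < n i`. -/
def keepCoords (m n : Fin k → ℕ) : (Fin k → ℕ) →+ (Fin k → ℕ) where
  toFun a i := if m i < n i then a i else 0
  map_zero' := by
    funext i
    simp
  map_add' a b := by
    funext i
    simp only [Pi.add_apply]
    split_ifs <;> rfl

theorem keepCoords_apply (m n a : Fin k → ℕ) (i : Fin k) :
    keepCoords m n a i = if m i < n i then a i else 0 := rfl

/-- Each generator is either fixed or killed, so the order of the surviving indices is preserved. -/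
theorem isAdmissible_keepCoords (m n : Fin k → ℕ) : IsAdmissible (keepCoords m n) := by
  have h1 : ∀ q, m q < n q → keepCoords m n (Pi.single q 1) = Pi.single q 1 := fun q hq => by
    funext i
    by_cases hi : i = q
    · subst hi
      simp [keepCoords_apply, hq]
    · simp [keepCoords_apply, hi]
  have h2 : ∀ q, ¬ m q < n q → keepCoords m n (Pi.single q 1) = 0 := fun q hq => by
    funext i
    by_cases hi : i = q
    · subst hi
      simp [keepCoords_apply, hq]
    · simp [keepCoords_apply, hi]
  have h3 : ∀ q a, keepCoords m n (Pi.single q 1) = Pi.single a 1 → q = a := fun q a h => by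
    by_cases hq : m q < n q
    · exact single_one_inj ((h1 q hq).symm.trans h)
    · have := congrFun ((h2 q hq).symm.trans h) a
      simp at this
  rw [isAdmissible_iff]
  refine ⟨fun q => ?_, fun q q' a a' hq ha ha' => ?_⟩
  · by_cases hq : m q < n q
    · exact Or.inr ⟨q, h1 q hq⟩
    · exact Or.inl (h2 q hq)
  · rwa [← h3 q a ha, ← h3 q' a' ha']

/-- Where `m i < d p i`, adding at most `1` stays within `d p`, so truncation has no effect;
elsewhere both corners are truncated to `d p i` and the difference vanishes. -/
theorem degree_cubeAtFunctor_map (p : Γ.Path) (m : Fin k → ℕ) {a b : (Cube k).Obj} (f : a ⟶ b) :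
    Γ.degree ((cubeAtFunctor p m ⋙ segmentFunctor p).map f) =
      keepCoords m (Γ.d p) ((Cube k).degree f) := by
  refine (degree_segmentFunctor_map p ((cubeAtFunctor p m).map f)).trans ?_
  change (m + a.unop.1) ⊓ Γ.d p - (m + b.unop.1) ⊓ Γ.d p =
    keepCoords m (Γ.d p) (a.unop.1 - b.unop.1)
  funext i
  have h1 : a.unop.1 i ≤ 1 := a.unop.2 i
  have h2 : b.unop.1 i ≤ a.unop.1 i := leOfHom f.unop i
  simp only [keepCoords_apply, Pi.sub_apply, Pi.inf_apply, Pi.add_apply]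
  split_ifs <;> omega

/-- The `k`-cube of `Γ` that is given by the part of `p` in the unit cube with corner `m`. -/
noncomputable def cubeAt (p : Γ.Path) (m : Fin k → ℕ) : Γ.RCube k :=
  ⟨cubeAtFunctor p m ⋙ segmentFunctor p, keepCoords m (Γ.d p), isAdmissible_keepCoords _ _,
    fun f => degree_cubeAtFunctor_map p m f⟩

theorem admissible_cubeAt (p : Γ.Path) (m : Fin k → ℕ) :
    (cubeAt p m).admissible = keepCoords m (Γ.d p) :=
  ((cubeAt p m).admissible_unique _ fun f => degree_cubeAtFunctor_map p m f).symm

theorem isSegment_cubeAt_path (p : Γ.Path) (m : Fin k → ℕ) {a b : (Cube k).Obj} (f : a ⟶ b) :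
    IsSegment p ((m + b.unop.1) ⊓ Γ.d p) ((m + a.unop.1) ⊓ Γ.d p) ((cubeAt p m).path f) :=
  isSegment_segmentFunctor p ((cubeAtFunctor p m).map f)

/-! ### The inverse of the comparison map -/

theorem isSegment_cell (x : Γ.Point) :
    IsSegment x.1 (fun i => ⌊x.2.1 i⌋₊) (fun i => ⌈x.2.1 i⌉₊) (Γ.cell x) :=
  isSegment_segment _ _ _ _ _

theorem ceil_le_d (x : Γ.Point) : (fun i => ⌈x.2.1 i⌉₊) ≤ Γ.d x.1 :=
  fun i => Nat.ceil_le.2 (x.2.2.2 i)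

/-- The offset of a point, as a point of the unit cube. -/
noncomputable def cubeOffset (x : Γ.Point) : Fin k → unitInterval :=
  fun i => ⟨Γ.offset x i, sub_nonneg.2 (Nat.floor_le (x.2.2.1 i)),
    (sub_lt_iff_lt_add'.2 (Nat.lt_floor_add_one _)).le⟩

/-- The point of `R Q̃(Γ)` that corresponds to a point `(p, t)`. -/
noncomputable def cubePoint (x : Γ.Point) : Γ.cubicalSet.Realisation :=
  Γ.cubicalSet.hat (r := k) (cubeAt (Γ.cell x) 0) (cubeOffset x)

theorem isSegment_cubeAt_cell_path (x : Γ.Point) {a b : (Cube k).Obj} (f : a ⟶ b) :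
    IsSegment x.1 ((fun i => ⌊x.2.1 i⌋₊) + (0 + b.unop.1) ⊓ Γ.d (Γ.cell x))
      ((fun i => ⌊x.2.1 i⌋₊) + (0 + a.unop.1) ⊓ Γ.d (Γ.cell x)) ((cubeAt (Γ.cell x) 0).path f) :=
  (isSegment_cell x).trans (isSegment_cubeAt_path (Γ.cell x) 0 f)
    (fun _ => Nat.floor_le_ceil _) (ceil_le_d x) inf_le_right

/-- A point on the boundary of a unit box may lie in several boxes. The cube of its cell is always a
substitution of `cubeAt x.1 m`, with constants where `s` is `0` or `1`, so `hat_substCoords` shows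
that the box does not matter. -/
theorem cubePoint_eq_hat (x : Γ.Point) (m : Fin k → ℕ) (s : Fin k → unitInterval)
    (hs : ∀ i, x.2.1 i = m i + s i) :
    cubePoint x = Γ.cubicalSet.hat (r := k) (cubeAt x.1 m) s := by
  classical
  let c : Fin k → Fin 2 ⊕ Fin k := fun i =>
    if s i = 0 then Sum.inl 0 else if s i = 1 then Sum.inl 1 else Sum.inr i
  have hinr : ∀ j i, c j = Sum.inr i → j = i := fun j i h => by
    simp only [c] at h
    split_ifs at h
    exact Sum.inr.inj h
  have hcase : ∀ i, (c i = Sum.inl 0 ∧ (s i : ℝ) = 0 ∧ ⌊x.2.1 i⌋₊ = m i ∧ ⌈x.2.1 i⌉₊ = m i) ∨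
      (c i = Sum.inl 1 ∧ (s i : ℝ) = 1 ∧ ⌊x.2.1 i⌋₊ = m i + 1 ∧ ⌈x.2.1 i⌉₊ = m i + 1) ∨
      (c i = Sum.inr i ∧ ⌊x.2.1 i⌋₊ = m i ∧ ⌈x.2.1 i⌉₊ = m i + 1) := fun i => by
    rw [hs i]
    by_cases h0 : s i = 0
    · left
      simp [c, h0]
    by_cases h1 : s i = 1
    · right
      left
      have h2 : (m i : ℝ) + ((1 : unitInterval) : ℝ) = ((m i + 1 : ℕ) : ℝ) := by simp
      refine ⟨by simp [c, h1], by simp [h1], ?_, ?_⟩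
      · rw [h1, h2, Nat.floor_natCast]
      · rw [h1, h2, Nat.ceil_natCast]
    · right
      right
      have h0' : (0 : ℝ) < s i := lt_of_le_of_ne (s i).2.1 fun h => h0 (Subtype.ext h.symm)
      have h1' : (s i : ℝ) < 1 := lt_of_le_of_ne (s i).2.2 fun h => h1 (Subtype.ext h)
      refine ⟨by simp [c, h0, h1], ?_, ?_⟩
      · rw [Nat.floor_eq_iff (by positivity)]
        constructor <;> linarith
      · rw [Nat.ceil_eq_iff (by omega)]
        push_cast
        constructor
        · simpa using h0'
        · linarith
  -- Both cubes have the same corners in `x.1`: in an integral direction the cell has degree zero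
  -- and the constant supplies the right end of the box.
  have hpt : ∀ a : Fin k → ℕ, a ≤ 1 → (fun i => ⌊x.2.1 i⌋₊) + (0 + a) ⊓ Γ.d (Γ.cell x) =
      (m + substCoords c a) ⊓ Γ.d x.1 := fun a ha => by
    funext i
    have h1 := congrFun (isSegment_cell x).degree_eq i
    have h2 := ceil_le_d x i
    have h3 : a i ≤ 1 := ha i
    simp only [Pi.sub_apply] at h1 h2
    simp only [Pi.add_apply, Pi.inf_apply, Pi.zero_apply, substCoords]
    rcases hcase i with ⟨h, -, hf, hc⟩ | ⟨h, -, hf, hc⟩ | ⟨h, hf, hc⟩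
    · simp only [h, Sum.elim_inl, if_true]
      omega
    · simp only [h, Sum.elim_inl, one_ne_zero, if_false]
      omega
    · simp only [h, Sum.elim_inr]
      omega
  -- The offset forgets whether an integral coordinate was `0` or `1` in the box; the constants of
  -- `c` restore it.
  have hsub : substCoords c (cubeOffset x) = s := by
    funext i
    simp only [substCoords]
    rcases hcase i with ⟨h, h', -⟩ | ⟨h, h', -⟩ | ⟨h, hf, -⟩
    · simp only [h, Sum.elim_inl, if_true]
      exact Subtype.ext h'.symm
    · simp only [h, Sum.elim_inl, one_ne_zero, if_false]
      exact Subtype.ext h'.symm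
    · simp only [h, Sum.elim_inr]
      refine Subtype.ext ?_
      change x.2.1 i - (⌊x.2.1 i⌋₊ : ℝ) = _
      rw [hf, hs]
      ring
  refine (hat_substCoords (k + k) rfl c (fun j j' i i' hj hi hi' => ?_) _ (cubeAt x.1 m)
    (RCube.functor_ext fun {a b} f => ?_) (cubeOffset x)).trans (congrArg _ hsub)
  · rwa [← hinr j i hi, ← hinr j' i' hi']
  · have h1 := isSegment_cubeAt_cell_path x f
    have h2 := isSegment_cubeAt_path x.1 m ((substFunctor c).map f)
    rw [hpt _ a.unop.2, hpt _ b.unop.2] at h1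
    exact h1.unique h2 (inf_le_inf_right _ (add_le_add_right
      (substCoords_mono c (leOfHom f.unop)) m)) inf_le_right

theorem cubePoint_eq_of_rel {x y : Γ.Point} (h : Γ.pointSetoid x y) :
    cubePoint x = cubePoint y := by
  have h1 : cubeOffset x = cubeOffset y := funext fun i => Subtype.ext (congrFun h.1 i)
  rw [cubePoint, cubePoint, h1, h.2]

/-- The inverse of the comparison map. -/
noncomputable def ofRealisation (Γ : KGraph.{u, v} k) :
    Γ.Realisation → Γ.cubicalSet.Realisation :=
  Quotient.lift cubePoint fun _ _ h => cubePoint_eq_of_rel h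

/-- For each path, finitely many closed unit boxes cover `[0, d p]`, and on each box the map is
given by one fixed cube. -/
theorem continuous_ofRealisation : Continuous Γ.ofRealisation := by
  refine continuous_quot_lift _ (continuous_sigma fun p => ?_)
  let C : Set.Iic (Γ.d p) → Set (Set.Icc (0 : Fin k → ℝ) (fun i => (Γ.d p i : ℝ))) :=
    fun m => {t | ∀ i, (m.1 i : ℝ) ≤ t.1 i ∧ t.1 i ≤ m.1 i + 1}
  have hcoord : ∀ i, Continuous
      fun t : Set.Icc (0 : Fin k → ℝ) (fun i => (Γ.d p i : ℝ)) => t.1 i :=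
    fun i => (continuous_apply i).comp continuous_subtype_val
  refine (locallyFinite_of_finite C).continuous ?_ (fun m => ?_) fun m => ?_
  -- The box at `⌊t⌋` contains `t`; corners with `m i = d p i` are allowed because the floor can
  -- attain that value.
  · refine Set.iUnion_eq_univ_iff.2 fun t => ⟨⟨fun i => ⌊t.1 i⌋₊, fun i => ?_⟩, fun i => ?_⟩
    · exact Nat.floor_le_of_le (t.2.2 i)
    · exact ⟨Nat.floor_le (t.2.1 i), (Nat.lt_floor_add_one _).le⟩
  · simp only [C, Set.ofPred_forall]
    refine isClosed_iInter fun i => ?_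
    exact (isClosed_le continuous_const (hcoord i)).inter (isClosed_le (hcoord i) continuous_const)
  -- Projection to `[0, 1]` makes the formula continuous on all of `[0, d p]`; on the box it is just
  -- `t - m`.
  · have hcont : Continuous fun t : Set.Icc (0 : Fin k → ℝ) (fun i => (Γ.d p i : ℝ)) =>
        Γ.cubicalSet.hat (r := k) (cubeAt p m.1)
          (fun i => Set.projIcc (0 : ℝ) 1 zero_le_one (t.1 i - m.1 i)) := by
      refine (Γ.cubicalSet.continuous_hat _).comp (continuous_pi fun i => ?_)
      exact continuous_projIcc.comp ((hcoord i).sub continuous_const)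
    refine hcont.continuousOn.congr fun t ht => cubePoint_eq_hat _ m.1 _ fun i => ?_
    rw [Set.projIcc_of_mem _ ⟨by linarith [(ht i).1], by linarith [(ht i).2]⟩]
    simp

/-- The real extension of an admissible map lands in the unit box at `0`, and each of its
coordinates is a variable or `0`. So `φ` is a substitution of `cubeAt φ.top 0`, and the two main
lemmas apply. -/
theorem ofRealisation_tilde {r : ℕ} (φ : Γ.RCube r) (t : Fin r → unitInterval) :
    Γ.ofRealisation (φ.tilde t) = Γ.cubicalSet.hat (r := r) φ t := by
  classical
  obtain ⟨hadm1, hadm2⟩ := (isAdmissible_iff φ.admissible).1 (Classical.choose_spec φ.2).1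
  -- Coordinate `j` reads the variable `q` with `h(e_q) = e_j` if there is one, and is `0`
  -- otherwise; `hinj` shows that `q` is unique.
  let c : Fin k → Fin 2 ⊕ Fin r := fun j =>
    if h : ∃ q, φ.admissible (Pi.single q 1) = Pi.single j 1 then Sum.inr h.choose else Sum.inl 0
  have hc : ∀ j q, c j = Sum.inr q → φ.admissible (Pi.single q 1) = Pi.single j 1 := fun j q h => by
    simp only [c] at h
    split_ifs at h with h'
    rw [← Sum.inr.inj h]
    exact h'.choose_spec
  have hc0 : ∀ j l, c j = Sum.inl l → l = 0 ∧ ∀ q, φ.admissible (Pi.single q 1) j = 0 :=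
    fun j l h => by
      simp only [c] at h
      split_ifs at h with h'
      refine ⟨(Sum.inl.inj h).symm, fun q => ?_⟩
      rcases hadm1 q with h0 | ⟨a, ha⟩
      · simp [h0]
      · have : j ≠ a := fun hj => h' ⟨q, hj ▸ ha⟩
        simp [ha, this]
  have hinj : ∀ q q' j, φ.admissible (Pi.single q 1) = Pi.single j 1 →
      φ.admissible (Pi.single q' 1) = Pi.single j 1 → q = q' := fun q q' j h h' => by
    rcases lt_trichotomy q q' with hq | hq | hq
    · exact absurd (hadm2 _ _ _ _ hq h h') (lt_irrefl _)
    · exact hq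
    · exact absurd (hadm2 _ _ _ _ hq h' h) (lt_irrefl _)
  -- Needed over `ℕ` for degrees of corners and over `ℝ` for points.
  have hsum : ∀ {R : Type} [CommSemiring R] (w : Fin r → R) (j : Fin k),
      ∑ q, w q * (φ.admissible (Pi.single q 1) j : R) = substCoords c w j := fun {R} _ w j => by
    rcases hj : c j with l | q
    · obtain ⟨rfl, h0⟩ := hc0 j l hj
      simp [substCoords, hj, h0]
    · rw [Finset.sum_eq_single q]
      · simp [substCoords, hj, hc j q hj]
      · intro q' _ hq'
        have : φ.admissible (Pi.single q' 1) j = 0 := by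
          rcases hadm1 q' with h0 | ⟨a, ha⟩
          · simp [h0]
          · have : j ≠ a := fun hj' => hq' (hinj _ _ a ha (hj' ▸ hc j q hj))
            simp [ha, this]
        simp [this]
      · simp
  have hnat : ∀ a, φ.admissible a = substCoords c a := fun a => funext fun j => by
    rw [φ.admissible_apply, ← hsum]
    simp
  -- Truncation is inactive, since `h(a) ≤ h(1) = d φ.top`.
  have hpt : ∀ a, a ≤ 1 → (0 + substCoords c a) ⊓ Γ.d φ.top = φ.admissible a := fun a ha => by
    rw [zero_add, ← hnat, φ.d_top]
    exact inf_eq_left.2 (φ.admissible_mono ha)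
  refine (cubePoint_eq_hat _ 0 (substCoords c t) fun j => ?_).trans
    (hat_substCoords (r + k) rfl c (fun j j' i i' hj hi hi' => ?_) φ (cubeAt φ.top 0)
      (RCube.functor_ext fun {a b} f => ?_) t).symm
  · refine (hsum (fun i => (t i : ℝ)) j).trans ?_
    simp only [substCoords, Pi.zero_apply, Nat.cast_zero, zero_add]
    rcases hj : c j with l | q
    · obtain ⟨rfl, -⟩ := hc0 j l hj
      simp
    · rfl
  · rcases lt_trichotomy i i' with h | h | h
    · exact h
    · subst h
      exact absurd (single_one_inj ((hc j i hi).symm.trans (hc j' i hi'))) hj.ne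
    · exact absurd (hadm2 _ _ _ _ h (hc j' i' hi') (hc j i hi)) hj.not_gt
  · have h1 := φ.isSegment_path f
    have h2 := isSegment_cubeAt_path φ.top 0 ((substFunctor c).map f)
    change IsSegment _ ((0 + substCoords c b.unop.1) ⊓ Γ.d φ.top)
      ((0 + substCoords c a.unop.1) ⊓ Γ.d φ.top) _ at h2
    rw [hpt _ a.unop.2, hpt _ b.unop.2] at h2
    exact h1.unique h2 (φ.admissible_mono (leOfHom f.unop))
      ((φ.admissible_mono a.unop.2).trans φ.d_top.ge)

/-- The top path of the cell's cube is a segment of `x.1` starting at `⌊t⌋`, and the admissible map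
preserves the offset. -/
theorem tilde_cubeAt_cell (x : Γ.Point) :
    (cubeAt (Γ.cell x) 0).tilde (cubeOffset x) = Γ.toRealisation x := by
  have h := isSegment_cubeAt_cell_path x (cubeTop k).hom
  refine (toRealisation_eq_of_isSegment (x := x) ?_ ?_ h fun i => ?_).symm
  · exact add_le_add_right (inf_le_inf_right _ (add_le_add_right zero_le_one 0)) _
  · intro i
    have h1 := congrFun (isSegment_cell x).degree_eq i
    have h2 := ceil_le_d x i
    have h3 := Nat.floor_le_ceil (x.2.1 i)
    simp only [Pi.sub_apply] at h1 h2
    simp only [Pi.add_apply, Pi.inf_apply]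
    omega
  · change x.2.1 i = (((fun i => ⌊x.2.1 i⌋₊) + (0 + 0) ⊓ Γ.d (Γ.cell x) : Fin k → ℕ) i : ℝ) +
      (cubeAt (Γ.cell x) 0).realMap (fun i => Γ.offset x i) i
    simp only [RCube.realMap, admissible_cubeAt, keepCoords_apply, Pi.single_apply]
    by_cases hd : 0 < Γ.d (Γ.cell x) i
    · simp [hd, offset]
    -- A direction killed by `keepCoords` has equal floor and ceiling, so the coordinate is integral
    -- and the discarded offset was already zero.
    · have h1 := congrFun (isSegment_cell x).degree_eq i
      simp only [Pi.sub_apply] at h1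
      have h2 : ⌈x.2.1 i⌉₊ ≤ ⌊x.2.1 i⌋₊ := by omega
      have h3 : x.2.1 i ≤ ⌊x.2.1 i⌋₊ := Nat.ceil_le.1 h2
      have h4 := h3.antisymm (Nat.floor_le (x.2.2.1 i))
      simp only [Pi.zero_apply, hd, if_false]
      simpa using h4

end KGraph

theorem mainTheorem9 {k : ℕ} (Γ : KGraph.{u, v} k) :
    (∃! π : C(Γ.cubicalSet.Realisation, Γ.Realisation),
      ∀ (r : ℕ) (φ : Γ.RCube r) (t : Fin r → unitInterval),
        π (Γ.cubicalSet.hat (r := r) φ t) = φ.tilde t) ∧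
    (∀ π : C(Γ.cubicalSet.Realisation, Γ.Realisation),
      (∀ (r : ℕ) (φ : Γ.RCube r) (t : Fin r → unitInterval),
        π (Γ.cubicalSet.hat (r := r) φ t) = φ.tilde t) → IsHomeomorph π) := by
  refine ⟨Γ.cubicalSet.existsUnique_desc (fun r (φ : Γ.RCube r) t => φ.tilde t)
    (fun r φ => KGraph.RCube.continuous_tilde φ)
    (fun r i l φ t => KGraph.RCube.tilde_coface φ i l t)
    (fun r i φ t => KGraph.RCube.tilde_codegen φ i t), fun π hπ => ?_⟩
  -- Only the prescribed values of `π` are used: both composites are checked on representatives, and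
  -- the second uses the `k`-cube of the cell of the point.
  refine isHomeomorph_iff_exists_inverse.2
    ⟨π.continuous, Γ.ofRealisation, fun y => ?_, fun x => ?_, KGraph.continuous_ofRealisation⟩
  · obtain ⟨⟨r, φ, t⟩, rfl⟩ := Quot.exists_rep y
    exact (congrArg Γ.ofRealisation (hπ r φ t)).trans (KGraph.ofRealisation_tilde φ t)
  · obtain ⟨x, rfl⟩ := Quotient.exists_rep x
    exact (hπ k _ _).trans (KGraph.tilde_cubeAt_cell x)
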